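/- Consider a market with $m$ resources, $n$ products, consumption matrix $A=(a_{ij})$ with entries in $\mathbb{Z}_{\ge 0}$ and columns $A^1,\dots,A^n$, prices $p\in\mathbb{R}^n$, initial inventory $c\in\mathbb{Z}_{\ge 0}^m$, selling horizon $[0,T]$, arrival rate $\lambda>0$ and choice probabilities $P_j(S)\ge 0$ for $S\subseteq\{1,\dots,n\}$ and $j\in\{0,1,\dots,n\}$ ($0$ is no purchase), with $P_j(S)=0$ for $j\in\{1,\dots,n\}\setminus S$ and $\sum_{j\in S\cup\{0\}}P_j(S)=1$. Let $\mathcal{X}=\prod_{i=1}^m\{0,\dots,c_i\}$ and, for $x\in\mathcal{X}$, let $\mathcal{A}(x)=\{S: x\ge A^j \text{ for all } j\in S\}$. Let $\boldsymbol\pi$ be an admissible randomized Markov policy: for all $t\in[0,T]$ and $x\in\mathcal{X}$, $\boldsymbol\pi(\cdot\mid t,x)$ is a probability distribution on the subsets of $\{1,\dots,n\}$ that vanishes outside $\mathcal{A}(x)$, and $t\mapsto\boldsymbol\pi(S\mid t,x)$ is continuous on $[0,T]$ for all $x$ and $S$. Customers arrive according to a Poisson process of rate $\lambda$. A customer who arrives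 at time $\tau\in[0,T]$ is offered a random assortment $S$ drawn from $\boldsymbol\pi(\cdot\mid\tau,X_{\tau-})$ and then chooses $j$ with probability $P_j(S)$; given the inventory at the arrival, the drawing of $S$ (and, given $S$, that of $j$) is independent of the arrival process and of the earlier offers and choices. Here $N_t=(N_{1,t},\dots,N_{n,t})^\top$ counts the units of each product sold up to time $t$, and $X_t=c-AN_t$. Let $\mathcal{H}(\boldsymbol\pi(\cdot\mid t,x))=-\sum_{S\in\mathcal{A}(x)}\boldsymbol\pi(S\mid t,x)\log\boldsymbol\pi(S\mid t,x)$, let $\gamma\ge 0$, and put $$G_t=\int_{(t,T]}p^\top dN_s+\gamma\int_t^T\mathcal{H}(\boldsymbol\pi(\cdot\mid s,X_{s-}))\,ds,\qquad J(t,x;\boldsymbol\pi)=\mathbb{E}[\,G_t\mid X_t=x\,].$$ Let $\{J^\theta:\theta\in\Theta\}$ be any family of functions $[0,T]\times\mathcal{X}\to\mathbb{R}$ that are measurable in $t$, and define, with values in $[0,\infty]$, $$L(\theta)=\tfrac12\,\mathbb{E}\Big[\int_0^T\big(G_t-J^\theta(t,X_t)\big)^2dt\Big],\qquad \mathrm{MSVE}(\theta)=\tfrac12\,\mathbb{E}\Big[\int_0^T\big|J(t,X_t;\boldsymbol\pi)-J^\theta(t,X_t)\big|^2dt\Big].$$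 Then $\operatorname{argmin}_{\theta\in\Theta}L(\theta)=\operatorname{argmin}_{\theta\in\Theta}\mathrm{MSVE}(\theta)$. In fact, there is a finite constant $C\ge 0$ that does not depend on $\theta$ with $L(\theta)=\mathrm{MSVE}(\theta)+C$ for all $\theta\in\Theta$. -/

import Mathlib

open MeasureTheory ProbabilityTheory
open scoped ENNReal NNReal

/-- The data of a choice-based network revenue management problem with `m` resources and
`n` products. An assortment is a `Finset (Fin n)`; a customer's choice is an `Option (Fin n)`,
where `none` is the no-purchase option. -/
structure Market (m n : ℕ) where
  /-- `consumption i j` is the amount of resource `i` used by one unit of product `j`. -/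
  consumption : Matrix (Fin m) (Fin n) ℕ
  /-- The fixed prices. -/
  price : Fin n → ℝ
  /-- The initial inventory. -/
  capacity : Fin m → ℕ
  /-- The customer arrival rate. -/
  rate : ℝ
  rate_pos : 0 < rate
  /-- `choiceProb S j` is the probability that a customer who is offered `S` chooses `j`. -/
  choiceProb : Finset (Fin n) → Option (Fin n) → ℝ
  choiceProb_nonneg : ∀ S j, 0 ≤ choiceProb S j
  choiceProb_not_offered : ∀ S j, j ∉ S → choiceProb S (some j) = 0
  choiceProb_sum : ∀ S, ∑ j, choiceProb S j = 1
  /-- The selling horizon is `[0, horizon]`. -/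
  horizon : ℝ
  horizon_nonneg : 0 ≤ horizon
  /-- The weight of the entropy bonus. -/
  temperature : ℝ
  temperature_nonneg : 0 ≤ temperature

namespace Market

variable {m n : ℕ} (M : Market m n)

/-- The state space `{0, …, c₁} × ⋯ × {0, …, cₘ}`, as a set of integer vectors. -/
def states : Set (Fin m → ℤ) :=
  {x | ∀ i, 0 ≤ x i ∧ x i ≤ M.capacity i}

open Classical in
/-- The assortments that are available in state `x`: there is enough inventory for one unit of
each offered product. -/
noncomputable def available (x : Fin m → ℤ) : Finset (Finset (Fin n)) :=
  Finset.univ.filter fun S => ∀ j ∈ S, ∀ i, (M.consumption i j : ℤ) ≤ x i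

/-- `π S t x` is the probability `π(S ∣ t, x)`. Only its values for `t ∈ [0, horizon]` and
`x` in the state space are meaningful. -/
structure IsRandomizedMarkovPolicy (π : Finset (Fin n) → ℝ → (Fin m → ℤ) → ℝ) : Prop where
  measurable : ∀ x ∈ M.states, ∀ S, Measurable fun t : Set.Icc (0 : ℝ) M.horizon => π S t x
  nonneg : ∀ t ∈ Set.Icc (0 : ℝ) M.horizon, ∀ x ∈ M.states, ∀ S, 0 ≤ π S t x
  sum_eq_one : ∀ t ∈ Set.Icc (0 : ℝ) M.horizon, ∀ x ∈ M.states, ∑ S, π S t x = 1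

/-- Admissible policies offer only available assortments and depend continuously on time. -/
structure IsAdmissible (π : Finset (Fin n) → ℝ → (Fin m → ℤ) → ℝ) : Prop
    extends M.IsRandomizedMarkovPolicy π where
  eq_zero_of_notMem : ∀ t ∈ Set.Icc (0 : ℝ) M.horizon, ∀ x ∈ M.states, ∀ S,
    S ∉ M.available x → π S t x = 0
  continuousOn : ∀ x ∈ M.states, ∀ S,
    ContinuousOn (fun t => π S t x) (Set.Icc (0 : ℝ) M.horizon)

/-- The entropy of `π(· ∣ t, x)`; recall `Real.negMulLog a = -a * Real.log a`. -/
noncomputable def entropy (π : Finset (Fin n) → ℝ → (Fin m → ℤ) → ℝ)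
    (t : ℝ) (x : Fin m → ℤ) : ℝ :=
  ∑ S ∈ M.available x, Real.negMulLog (π S t x)

end Market

/-- The random elements of a sales trajectory: the times between successive customer arrivals,
the assortment offered to each customer, and each customer's choice. Customers are numbered
from `0`. -/
structure Trajectory (n : ℕ) (Ω : Type*) where
  gap : ℕ → Ω → ℝ
  offer : ℕ → Ω → Finset (Fin n)
  choice : ℕ → Ω → Option (Fin n)

namespace Trajectory

variable {m n : ℕ} {Ω : Type*} (X : Trajectory n Ω)

/-- The arrival time of customer `k`. -/
def arrival (k : ℕ) (ω : Ω) : ℝ := ∑ i ∈ Finset.range (k + 1), X.gap i ω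

/-- `N_{j,t}`: the number of units of product `j` sold up to and including time `t`. -/
noncomputable def sales (j : Fin n) (t : ℝ) (ω : Ω) : ℕ :=
  Set.ncard {k : ℕ | X.arrival k ω ≤ t ∧ X.choice k ω = some j}

/-- `N_{j,t-}`: the number of units of product `j` sold strictly before time `t`. -/
noncomputable def salesBefore (j : Fin n) (t : ℝ) (ω : Ω) : ℕ :=
  Set.ncard {k : ℕ | X.arrival k ω < t ∧ X.choice k ω = some j}

/-- The remaining inventory `X_t = c - A N_t`. -/
noncomputable def inventory (M : Market m n) (t : ℝ) (ω : Ω) : Fin m → ℤ :=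
  fun i => M.capacity i - ∑ j, (M.consumption i j : ℤ) * X.sales j t ω

/-- The left limit `X_{t-} = c - A N_{t-}` of the remaining inventory. -/
noncomputable def inventoryBefore (M : Market m n) (t : ℝ) (ω : Ω) : Fin m → ℤ :=
  fun i => M.capacity i - ∑ j, (M.consumption i j : ℤ) * X.salesBefore j t ω

/-- The information available when the assortment for customer `k` is drawn: the arrival process
and the offers to and choices of the earlier customers. (The arrival process may be included as a
whole, since the randomization of the offers and of the choices is independent of it.) -/
abbrev past (k : ℕ) : MeasurableSpace Ω :=
  (⨆ i : ℕ, MeasurableSpace.comap (X.gap i) inferInstance) ⊔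
    ⨆ i : Fin k, (MeasurableSpace.comap (X.offer i) ⊤ ⊔ MeasurableSpace.comap (X.choice i) ⊤)

/-- The trajectory evolves in the market `M` under the randomized policy `π`:
customers arrive according to a Poisson process (independent exponential interarrival times);
a customer who arrives at a time `τ` in the horizon is offered an assortment drawn from
`π(· ∣ τ, X_{τ-})`; a customer who is offered `S` chooses `j` with probability `P_j(S)`. -/
structure IsControlled [MeasurableSpace Ω] (P : Measure Ω) (M : Market m n)
    (π : Finset (Fin n) → ℝ → (Fin m → ℤ) → ℝ) : Prop where
  measurable_gap : ∀ k, Measurable (X.gap k)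
  measurable_offer : ∀ k S, MeasurableSet {ω | X.offer k ω = S}
  measurable_choice : ∀ k j, MeasurableSet {ω | X.choice k ω = j}
  indep_gap : iIndepFun X.gap P
  law_gap : ∀ k, P.map (X.gap k) = expMeasure M.rate
  law_offer : ∀ k S, ∀ᵐ ω ∂P, X.arrival k ω ≤ M.horizon →
    (P[Set.indicator {ω' | X.offer k ω' = S} (fun _ => (1 : ℝ)) | X.past k]) ω =
      π S (X.arrival k ω) (X.inventoryBefore M (X.arrival k ω) ω)
  law_choice : ∀ k j, ∀ᵐ ω ∂P,
    (P[Set.indicator {ω' | X.choice k ω' = j} (fun _ => (1 : ℝ)) |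
        X.past k ⊔ MeasurableSpace.comap (X.offer k) ⊤]) ω =
      M.choiceProb (X.offer k ω) j

/-- The realized revenue in `(t, T]` plus the entropy bonus:
`∫_{(t,T]} pᵀ dN_s + γ ∫_t^T H(π(· ∣ s, X_{s-})) ds`. -/
noncomputable def rewardToGo (M : Market m n) (π : Finset (Fin n) → ℝ → (Fin m → ℤ) → ℝ)
    (t : ℝ) (ω : Ω) : ℝ :=
  ∑ j, M.price j * ((X.sales j M.horizon ω : ℝ) - X.sales j t ω) +
    M.temperature * ∫ s in t..M.horizon, M.entropy π s (X.inventoryBefore M s ω)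

/-- The value function `J(t, x; π)`: the expected reward-to-go given the event `X_t = x`
(which matters only if this event has positive probability). -/
noncomputable def value [MeasurableSpace Ω] (P : Measure Ω) (M : Market m n)
    (π : Finset (Fin n) → ℝ → (Fin m → ℤ) → ℝ) (t : ℝ) (x : Fin m → ℤ) : ℝ :=
  ∫ ω, X.rewardToGo M π t ω ∂(ProbabilityTheory.cond P {ω | X.inventory M t ω = x})

/-- The Monte Carlo loss of an approximate value function `v`, an expectation in `[0, ∞]`. -/
noncomputable def monteCarloLoss [MeasurableSpace Ω] (P : Measure Ω) (M : Market m n)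
    (π : Finset (Fin n) → ℝ → (Fin m → ℤ) → ℝ) (v : ℝ → (Fin m → ℤ) → ℝ) : ℝ≥0∞ :=
  2⁻¹ * ∫⁻ ω, (∫⁻ t in Set.Icc (0 : ℝ) M.horizon,
    ENNReal.ofReal ((X.rewardToGo M π t ω - v t (X.inventory M t ω)) ^ 2)) ∂P

/-- The mean-squared value error of an approximate value function `v`, an expectation in
`[0, ∞]`. -/
noncomputable def msve [MeasurableSpace Ω] (P : Measure Ω) (M : Market m n)
    (π : Finset (Fin n) → ℝ → (Fin m → ℤ) → ℝ) (v : ℝ → (Fin m → ℤ) → ℝ) : ℝ≥0∞ :=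
  2⁻¹ * ∫⁻ ω, (∫⁻ t in Set.Icc (0 : ℝ) M.horizon,
    ENNReal.ofReal (|X.value P M π t (X.inventory M t ω) - v t (X.inventory M t ω)| ^ 2)) ∂P

end Trajectory

/-- The set of minimizers of `f`. -/
def argmin {Θ : Type*} (f : Θ → ℝ≥0∞) : Set Θ := {θ | ∀ θ', f θ ≤ f θ'}

/-!
The Monte Carlo loss and the mean-squared value error differ by the integrated conditional variance
of the reward-to-go `G_t` given `X_t`, which does not involve the approximation. For a fixed time
this is the bias-variance decomposition `lintegral_sq_sub_comp`: on each event `X_t = x` the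
function `v t` is a constant, and the mean of `(G_t - a) ^ 2` is minimal at the conditional mean
`J(t, x)`, the excess being `(J(t, x) - a) ^ 2`. Tonelli's theorem integrates this over time
(`exists_lintegral_sq_sub_eq_add`). As the losses may be infinite, all of this is done in
`[0, ∞]`, and what has to be verified is that `(t, ω) ↦ G_t ω` is measurable with a finite
second moment over time and paths.

* The approximations and the policy are only controlled on the state space, so the inventory must
  almost surely stay there (`IsControlled.ae_isRegularPath` and
  `IsRegularPath.inventory_mem_states`). An offer that is not available has conditional probability
  zero, and so has the choice of a product that is not offered; both are therefore almost surely
  absent, and the rest is an induction over the customers.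
* A product may consume no resources, so sales are not bounded by the inventory. They are bounded by
  the number of arrivals, whose second moment is finite because the tails are geometric
  (`IsControlled.measureReal_arrival_le`, a Chernoff bound for sums of exponential variables).
* The entropy bonus is bounded because `0 ≤ -a log a ≤ 1` on `[0, 1]`.
-/

/-! ### Bias-variance decomposition -/

section BiasVariance

variable {Ω E 𝒯 : Type*} [MeasurableSpace Ω] [MeasurableSpace E] [MeasurableSpace 𝒯]

/-- The mean of `(f - a) ^ 2` exceeds its value at the mean `b` of `f` by `(b - a) ^ 2`; here `μ`
need not be a probability measure. -/
lemma lintegral_sq_sub_const (μ : Measure Ω) [IsFiniteMeasure μ] {f : Ω → ℝ} (hf : MemLp f 2 μ)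
    {b : ℝ} (hb : ∫ ω, f ω ∂μ = μ.real Set.univ * b) (a : ℝ) :
    ∫⁻ ω, ENNReal.ofReal ((f ω - a) ^ 2) ∂μ =
      ∫⁻ ω, ENNReal.ofReal ((f ω - b) ^ 2) ∂μ + ∫⁻ _, ENNReal.ofReal ((b - a) ^ 2) ∂μ := by
  have hsq (r : ℝ) : Integrable (fun ω => (f ω - r) ^ 2) μ :=
    (hf.sub (memLp_const r)).integrable_sq
  have hf1 : Integrable f μ := hf.integrable one_le_two
  have hc : Integrable (fun _ : Ω => (b - a) ^ 2) μ := integrable_const _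
  rw [← ofReal_integral_eq_lintegral_ofReal (hsq a) (.of_forall fun _ => sq_nonneg _),
    ← ofReal_integral_eq_lintegral_ofReal (hsq b) (.of_forall fun _ => sq_nonneg _),
    ← ofReal_integral_eq_lintegral_ofReal hc (.of_forall fun _ => sq_nonneg _),
    ← ENNReal.ofReal_add (integral_nonneg fun _ => sq_nonneg _)
      (integral_nonneg fun _ => sq_nonneg _)]
  congr 1
  have hcross : ∫ ω, 2 * (b - a) * (f ω - b) ∂μ = 0 := by
    rw [integral_const_mul, integral_sub hf1 (integrable_const b), hb]
    simp
  have hcross_int : Integrable (fun ω => 2 * (b - a) * (f ω - b)) μ :=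
    (hf1.sub (integrable_const b)).const_mul _
  have hsum := integral_add ((hsq b).add hc) hcross_int
  rw [hcross, add_zero] at hsum
  rw [← integral_add (hsq b) hc]
  refine Eq.trans (integral_congr_ae (.of_forall fun ω => ?_)) hsum
  simp only [Pi.add_apply]
  ring

/-- The conditional mean of a process given the event `Y_t = x` depends measurably on time. -/
lemma measurable_integral_cond [MeasurableSingletonClass E] (P : Measure Ω)
    [IsProbabilityMeasure P] {Y : 𝒯 × Ω → E}
    (hY : Measurable Y) {G : 𝒯 × Ω → ℝ} (hG : Measurable G) (x : E) :
    Measurable fun t => ∫ ω, G (t, ω) ∂(ProbabilityTheory.cond P ((fun ω => Y (t, ω)) ⁻¹' {x})) := by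
  have hx : MeasurableSet (Y ⁻¹' {x}) := hY (measurableSet_singleton x)
  have h1 : Measurable fun t => P (Prod.mk t ⁻¹' (Y ⁻¹' {x})) := measurable_measure_prodMk_left hx
  have h2 : Measurable fun t => ∫ ω, (Y ⁻¹' {x}).indicator G (t, ω) ∂P :=
    ((hG.indicator hx).stronglyMeasurable.integral_prod_right').measurable
  convert (h1.inv.ennreal_toReal).mul h2 using 2 with t
  rw [ProbabilityTheory.cond, integral_smul_measure, smul_eq_mul]
  congr 1
  exact (integral_indicator ((hY.comp measurable_prodMk_left) (measurableSet_singleton x))).symm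

variable [Countable E] [MeasurableSingletonClass E]

lemma lintegral_eq_tsum_fiber (P : Measure Ω) {Y : Ω → E} (hY : Measurable Y)
    (g : Ω → ℝ≥0∞) : ∫⁻ ω, g ω ∂P = ∑' x, ∫⁻ ω in Y ⁻¹' {x}, g ω ∂P := by
  rw [← lintegral_iUnion (fun x => hY (measurableSet_singleton x))
    (fun x y hxy => Set.disjoint_left.2 fun ω h1 h2 => hxy (h1.symm.trans h2)),
    ← Set.preimage_iUnion, Set.iUnion_of_singleton, Set.preimage_univ, Measure.restrict_univ]

/-- Bias-variance decomposition: among the functions of a discrete random variable `Y`, the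
conditional mean of `f` given `Y` is the mean-square projection of `f`. -/
lemma lintegral_sq_sub_comp (P : Measure Ω) [IsProbabilityMeasure P] {Y : Ω → E}
    (hY : Measurable Y) {f : Ω → ℝ} (hf : MemLp f 2 P) {w : E → ℝ}
    (hw : ∀ x, w x = ∫ ω, f ω ∂(ProbabilityTheory.cond P (Y ⁻¹' {x}))) (v : E → ℝ) :
    ∫⁻ ω, ENNReal.ofReal ((f ω - v (Y ω)) ^ 2) ∂P =
      ∫⁻ ω, ENNReal.ofReal ((f ω - w (Y ω)) ^ 2) ∂P +
        ∫⁻ ω, ENNReal.ofReal ((w (Y ω) - v (Y ω)) ^ 2) ∂P := by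
  simp only [lintegral_eq_tsum_fiber P hY]
  rw [← ENNReal.tsum_add]
  refine tsum_congr fun x => ?_
  have hx : MeasurableSet (Y ⁻¹' {x}) := hY (measurableSet_singleton x)
  have hfiber (g : Ω → E → ℝ≥0∞) :
      ∫⁻ ω in Y ⁻¹' {x}, g ω (Y ω) ∂P = ∫⁻ ω in Y ⁻¹' {x}, g ω x ∂P :=
    setLIntegral_congr_fun hx fun ω hω => congrArg (g ω) hω
  refine (hfiber fun ω y => ENNReal.ofReal ((f ω - v y) ^ 2)).trans <| Eq.trans ?_ <|
    (congrArg₂ (· + ·) (hfiber fun ω y => ENNReal.ofReal ((f ω - w y) ^ 2))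
      (hfiber fun _ y => ENNReal.ofReal ((w y - v y) ^ 2))).symm
  refine lintegral_sq_sub_const _ (hf.restrict _) ?_ _
  rw [hw, ProbabilityTheory.cond, integral_smul_measure, measureReal_restrict_apply_univ,
    smul_eq_mul, ENNReal.toReal_inv, ← mul_assoc, ← measureReal_def]
  rcases eq_or_ne (P.real (Y ⁻¹' {x})) 0 with h | h
  · rw [h, zero_mul, zero_mul]
    rw [measureReal_eq_zero_iff] at h
    rw [Measure.restrict_eq_zero.2 h, integral_zero_measure]
  · rw [mul_inv_cancel₀ h, one_mul]

/-- The bias-variance decomposition of a process, integrated over time. The constant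
`C` is the integrated conditional variance. -/
lemma exists_lintegral_sq_sub_eq_add (P : Measure Ω) [IsProbabilityMeasure P]
    (ν : Measure 𝒯) [SFinite ν] {Y : 𝒯 × Ω → E} (hY : Measurable Y) {G : 𝒯 × Ω → ℝ}
    (hG : Measurable G)
    (hfin : ∫⁻ ω, ∫⁻ t, ENNReal.ofReal (G (t, ω) ^ 2) ∂ν ∂P ≠ ∞) :
    ∃ C : ℝ≥0, ∀ v : 𝒯 → E → ℝ, (∀ x, Measurable fun t => v t x) →
      ∫⁻ ω, ∫⁻ t, ENNReal.ofReal ((G (t, ω) - v t (Y (t, ω))) ^ 2) ∂ν ∂P =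
        ∫⁻ ω, ∫⁻ t, ENNReal.ofReal
          (((∫ ω', G (t, ω') ∂(ProbabilityTheory.cond P
            ((fun ω' => Y (t, ω')) ⁻¹' {Y (t, ω)}))) - v t (Y (t, ω))) ^ 2) ∂ν ∂P + C := by
  set w : 𝒯 → E → ℝ := fun t x =>
    ∫ ω', G (t, ω') ∂(ProbabilityTheory.cond P ((fun ω' => Y (t, ω')) ⁻¹' {x}))
  have hcomp (v : 𝒯 → E → ℝ) (hv : ∀ x, Measurable fun t => v t x) :
      Measurable fun z : 𝒯 × Ω => v z.1 (Y z) :=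
    (measurable_from_prod_countable_left (f := fun z : 𝒯 × E => v z.1 z.2) hv).comp
      (measurable_fst.prodMk hY)
  have hwm := hcomp w (measurable_integral_cond P hY hG)
  have hswap (g : 𝒯 × Ω → ℝ) (hg : Measurable g) :
      ∫⁻ ω, ∫⁻ t, ENNReal.ofReal (g (t, ω) ^ 2) ∂ν ∂P =
        ∫⁻ t, ∫⁻ ω, ENNReal.ofReal (g (t, ω) ^ 2) ∂P ∂ν :=
    lintegral_lintegral_swap
      ((hg.pow_const 2).ennreal_ofReal.comp measurable_swap).aemeasurable
  have hL2 : ∀ᵐ t ∂ν, MemLp (fun ω => G (t, ω)) 2 P := by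
    rw [hswap G hG] at hfin
    filter_upwards [ae_lt_top (hG.pow_const 2).ennreal_ofReal.lintegral_prod_right' hfin]
      with t ht
    have hm : Measurable fun ω => G (t, ω) := hG.comp measurable_prodMk_left
    refine (memLp_two_iff_integrable_sq hm.aestronglyMeasurable).2
      ⟨(hm.pow_const 2).aestronglyMeasurable, ?_⟩
    rwa [hasFiniteIntegral_iff_ofReal (.of_forall fun _ => sq_nonneg _)]
  have key (v : 𝒯 → E → ℝ) (hv : ∀ x, Measurable fun t => v t x) :
      ∫⁻ ω, ∫⁻ t, ENNReal.ofReal ((G (t, ω) - v t (Y (t, ω))) ^ 2) ∂ν ∂P =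
        ∫⁻ ω, ∫⁻ t, ENNReal.ofReal ((w t (Y (t, ω)) - v t (Y (t, ω))) ^ 2) ∂ν ∂P +
        ∫⁻ ω, ∫⁻ t, ENNReal.ofReal ((G (t, ω) - w t (Y (t, ω))) ^ 2) ∂ν ∂P := by
    have hvm := hcomp v hv
    rw [hswap (fun z => G z - v z.1 (Y z)) (hG.sub hvm),
      hswap (fun z => G z - w z.1 (Y z)) (hG.sub hwm),
      hswap (fun z => w z.1 (Y z) - v z.1 (Y z)) (hwm.sub hvm)]
    have hvar : Measurable fun t => ∫⁻ ω, ENNReal.ofReal ((G (t, ω) - w t (Y (t, ω))) ^ 2) ∂P :=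
      ((hG.sub hwm).pow_const 2).ennreal_ofReal.lintegral_prod_right'
    refine Eq.trans (lintegral_congr_ae ?_) (lintegral_add_right _ hvar)
    filter_upwards [hL2] with t ht
    rw [add_comm]
    exact lintegral_sq_sub_comp P (hY.comp measurable_prodMk_left) ht (fun _ => rfl) (v t)
  have hC : ∫⁻ ω, ∫⁻ t, ENNReal.ofReal ((G (t, ω) - w t (Y (t, ω))) ^ 2) ∂ν ∂P ≠ ∞ := by
    have h0 := key (fun _ _ => 0) fun _ => measurable_const
    simp only [sub_zero] at h0
    rw [h0] at hfin
    exact (ENNReal.add_ne_top.1 hfin).2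
  lift ∫⁻ ω, ∫⁻ t, ENNReal.ofReal ((G (t, ω) - w t (Y (t, ω))) ^ 2) ∂ν ∂P to ℝ≥0 using hC
    with C
  exact ⟨C, key⟩

end BiasVariance

namespace Trajectory

variable {m n : ℕ} {Ω : Type*} (X : Trajectory n Ω)

/-! ### Regular paths -/

section Pathwise

/-- The properties, shared by almost every path, that keep the inventory in the state space:
customers arrive one by one and do not accumulate, an offer drawn in the state space within the
horizon is available, and customers only buy what they are offered. -/
structure IsRegularPath (M : Market m n) (ω : Ω) : Prop where
  gap_pos : ∀ k, 0 < X.gap k ω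
  arrival_unbounded : ∀ t : ℝ, ∃ k, t < X.arrival k ω
  offer_available : ∀ k, X.arrival k ω ≤ M.horizon →
    X.inventoryBefore M (X.arrival k ω) ω ∈ M.states →
      X.offer k ω ∈ M.available (X.inventoryBefore M (X.arrival k ω) ω)
  choice_offered : ∀ k j, X.choice k ω = some j → j ∈ X.offer k ω

/-- The inventory that is left after the first `K` customers. -/
noncomputable def inventoryAfter (M : Market m n) (K : ℕ) (ω : Ω) : Fin m → ℤ :=
  fun i => M.capacity i - ∑ j, (M.consumption i j : ℤ) *
    Set.ncard {k : ℕ | k < K ∧ X.choice k ω = some j}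

lemma inventoryAfter_zero (M : Market m n) (ω : Ω) (i : Fin m) :
    X.inventoryAfter M 0 ω i = M.capacity i := by
  simp [inventoryAfter]

lemma inventoryAfter_le (M : Market m n) (K : ℕ) (ω : Ω) (i : Fin m) :
    X.inventoryAfter M K ω i ≤ M.capacity i :=
  sub_le_self _ (Finset.sum_nonneg fun _ _ => by positivity)

lemma inventoryAfter_succ_of_none (M : Market m n) {K : ℕ} {ω : Ω} (h : X.choice K ω = none) :
    X.inventoryAfter M (K + 1) ω = X.inventoryAfter M K ω := by
  have hset (j : Fin n) : {k : ℕ | k < K + 1 ∧ X.choice k ω = some j} =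
      {k : ℕ | k < K ∧ X.choice k ω = some j} := by
    ext k
    simp only [Set.mem_ofPred_eq]
    refine and_congr_left fun hk => ?_
    have : k ≠ K := by
      rintro rfl
      simp [h] at hk
    omega
  funext i
  simp only [inventoryAfter, hset]

lemma inventoryAfter_succ_of_some (M : Market m n) {K : ℕ} {ω : Ω} {j : Fin n}
    (h : X.choice K ω = some j) (i : Fin m) :
    X.inventoryAfter M (K + 1) ω i = X.inventoryAfter M K ω i - M.consumption i j := by
  have hcard (j' : Fin n) : Set.ncard {k : ℕ | k < K + 1 ∧ X.choice k ω = some j'} =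
      Set.ncard {k : ℕ | k < K ∧ X.choice k ω = some j'} + if j' = j then 1 else 0 := by
    have hfin : {k : ℕ | k < K ∧ X.choice k ω = some j'}.Finite :=
      (Set.finite_Iio K).subset fun k hk => hk.1
    split_ifs with hj
    · subst hj
      rw [← Set.ncard_insert_of_notMem (a := K) (by simp) hfin]
      congr 1
      ext k
      simp only [Set.mem_ofPred_eq, Set.mem_insert_iff]
      constructor
      · rintro ⟨h1, h2⟩
        rcases Nat.lt_succ_iff_lt_or_eq.1 h1 with h3 | h3
        · exact .inr ⟨h3, h2⟩
        · exact .inl h3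
      · rintro (rfl | ⟨h1, h2⟩)
        · exact ⟨Nat.lt_succ_self _, h⟩
        · exact ⟨by omega, h2⟩
    · rw [add_zero]
      congr 1
      ext k
      simp only [Set.mem_ofPred_eq]
      refine and_congr_left fun hk => ?_
      have : k ≠ K := by
        rintro rfl
        rw [h, Option.some_inj] at hk
        exact hj hk.symm
      omega
  simp only [inventoryAfter, hcard]
  push_cast
  simp only [mul_add, Finset.sum_add_distrib, mul_ite, mul_one, mul_zero, Finset.sum_ite_eq',
    Finset.mem_univ, if_true]
  ring

variable {X} {M : Market m n} {ω : Ω}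

namespace IsRegularPath

lemma strictMono_arrival (h : X.IsRegularPath M ω) : StrictMono fun k => X.arrival k ω :=
  strictMono_nat_of_lt_succ fun k => by
    simp only [arrival]
    rw [Finset.sum_range_succ _ (k + 1)]
    exact lt_add_of_pos_right _ (h.gap_pos _)

lemma exists_arrival_le_iff (h : X.IsRegularPath M ω) (t : ℝ) :
    ∃ K, ∀ k, X.arrival k ω ≤ t ↔ k < K := by
  classical
  refine ⟨Nat.find (h.arrival_unbounded t), fun k => ⟨fun hk => ?_, fun hk => ?_⟩⟩
  · by_contra! hlt
    exact (hk.trans_lt (Nat.find_spec (h.arrival_unbounded t))).not_ge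
      (h.strictMono_arrival.monotone hlt)
  · exact not_lt.1 (Nat.find_min _ hk)

lemma exists_arrival_lt_iff (h : X.IsRegularPath M ω) (t : ℝ) :
    ∃ K, ∀ k, X.arrival k ω < t ↔ k < K := by
  classical
  have hex : ∃ k, t ≤ X.arrival k ω := (h.arrival_unbounded t).imp fun _ => le_of_lt
  refine ⟨Nat.find hex, fun k => ⟨fun hk => ?_, fun hk => ?_⟩⟩
  · by_contra! hlt
    exact (hk.trans_le (Nat.find_spec hex)).not_ge (h.strictMono_arrival.monotone hlt)
  · exact not_le.1 (Nat.find_min _ hk)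

lemma inventoryBefore_arrival (h : X.IsRegularPath M ω) (k : ℕ) :
    X.inventoryBefore M (X.arrival k ω) ω = X.inventoryAfter M k ω := by
  funext i
  simp only [inventoryBefore, inventoryAfter, salesBefore, h.strictMono_arrival.lt_iff_lt]

lemma inventoryAfter_mem_states (h : X.IsRegularPath M ω) (K : ℕ)
    (hK : ∀ k < K, X.arrival k ω ≤ M.horizon) : X.inventoryAfter M K ω ∈ M.states := by
  induction K with
  | zero => exact fun i => by simp [inventoryAfter_zero]
  | succ K ih =>
    have hmem := ih fun k hk => hK k (hk.trans (Nat.lt_succ_self K))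
    rcases hc : X.choice K ω with _ | j
    · rwa [inventoryAfter_succ_of_none X M hc]
    · refine fun i => ⟨?_, X.inventoryAfter_le M _ ω i⟩
      have hav := h.offer_available K (hK K (Nat.lt_succ_self K))
      rw [h.inventoryBefore_arrival] at hav
      have hle := (Finset.mem_filter.1 (hav hmem)).2 j (h.choice_offered K j hc) i
      rw [inventoryAfter_succ_of_some X M hc]
      omega

lemma inventory_mem_states (h : X.IsRegularPath M ω) {t : ℝ} (ht : t ≤ M.horizon) :
    X.inventory M t ω ∈ M.states := by
  obtain ⟨K, hK⟩ := h.exists_arrival_le_iff t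
  have heq : X.inventory M t ω = X.inventoryAfter M K ω := by
    funext i
    simp only [inventory, inventoryAfter, sales, hK]
  rw [heq]
  exact h.inventoryAfter_mem_states K fun k hk => ((hK k).2 hk).trans ht

lemma inventoryBefore_mem_states (h : X.IsRegularPath M ω) {t : ℝ} (ht : t ≤ M.horizon) :
    X.inventoryBefore M t ω ∈ M.states := by
  obtain ⟨K, hK⟩ := h.exists_arrival_lt_iff t
  have heq : X.inventoryBefore M t ω = X.inventoryAfter M K ω := by
    funext i
    simp only [inventoryBefore, inventoryAfter, salesBefore, hK]
  rw [heq]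
  exact h.inventoryAfter_mem_states K fun k hk => ((hK k).2 hk).le.trans ht

lemma sales_mono (h : X.IsRegularPath M ω) (j : Fin n) {s t : ℝ} (hst : s ≤ t) :
    X.sales j s ω ≤ X.sales j t ω := by
  obtain ⟨K, hK⟩ := h.exists_arrival_le_iff t
  exact Set.ncard_le_ncard (fun k hk => ⟨hk.1.trans hst, hk.2⟩)
    ((Set.finite_Iio K).subset fun k hk => (hK k).1 hk.1)

/-- Sales are at most the number `K` of arrivals, and `K ^ 2 = ∑ k < K, (2 * k + 1)`. -/
lemma sq_sales_le (h : X.IsRegularPath M ω) (j : Fin n) (t : ℝ) :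
    ENNReal.ofReal ((X.sales j t ω : ℝ) ^ 2) ≤
      ∑' k : ℕ, {ω' | X.arrival k ω' ≤ t}.indicator (fun _ => ((2 * k + 1 : ℕ) : ℝ≥0∞)) ω := by
  obtain ⟨K, hK⟩ := h.exists_arrival_le_iff t
  have hle : X.sales j t ω ≤ K := by
    calc X.sales j t ω ≤ (Set.Iio K).ncard :=
          Set.ncard_le_ncard (fun k hk => (hK k).1 hk.1) (Set.finite_Iio K)
      _ = K := by rw [← Finset.coe_Iio, Set.ncard_coe_finset, Nat.card_Iio]
  have hsq : ∑ k ∈ Finset.range K, (2 * k + 1) = K ^ 2 := by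
    clear hle hK
    induction K with
    | zero => rfl
    | succ K ih => rw [Finset.sum_range_succ, ih]; ring
  calc ENNReal.ofReal ((X.sales j t ω : ℝ) ^ 2)
      = ((X.sales j t ω ^ 2 : ℕ) : ℝ≥0∞) := by
        rw [← Nat.cast_pow, ENNReal.ofReal_natCast]
    _ ≤ ((K ^ 2 : ℕ) : ℝ≥0∞) := by gcongr
    _ = ∑ k ∈ Finset.range K,
          {ω' | X.arrival k ω' ≤ t}.indicator (fun _ => ((2 * k + 1 : ℕ) : ℝ≥0∞)) ω := by
        rw [← hsq, Nat.cast_sum]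
        refine Finset.sum_congr rfl fun k hk => ?_
        rw [Set.indicator_of_mem]
        exact (hK k).2 (Finset.mem_range.1 hk)
    _ ≤ _ := ENNReal.sum_le_tsum _

end IsRegularPath

end Pathwise

/-! ### Measurability of sales and inventory -/

section Measurability

lemma _root_.measurable_ncard_setOf_mem {α : Type*} [MeasurableSpace α] {A : ℕ → Set α}
    (hA : ∀ k, MeasurableSet (A k)) : Measurable fun a => Set.ncard {k | a ∈ A k} := by
  have hreal : Measurable fun a => (∑' k, (A k).indicator (1 : α → ℝ≥0∞) a).toReal :=
    (Measurable.tsum fun k => measurable_one.indicator (hA k)).ennreal_toReal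
  convert Nat.measurable_floor.comp hreal using 2 with a
  have hsum : ∑' k, (A k).indicator (1 : α → ℝ≥0∞) a = ({k | a ∈ A k}.encard : ℝ≥0∞) := by
    rw [← ENNReal.tsum_set_one, tsum_subtype {k | a ∈ A k} fun _ => (1 : ℝ≥0∞)]
    rfl
  rw [Function.comp_apply, hsum, Set.ncard_def]
  -- An infinite set has `ncard` equal to `0`, in agreement with `ENNReal.toReal ∞ = 0`.
  cases h : {k | a ∈ A k}.encard <;> simp

variable [MeasurableSpace Ω] {P : Measure Ω} {M : Market m n}
  {π : Finset (Fin n) → ℝ → (Fin m → ℤ) → ℝ} {X}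

namespace IsControlled

variable (hX : X.IsControlled P M π)
include hX

lemma measurable_arrival (k : ℕ) : Measurable (X.arrival k) :=
  Finset.measurable_fun_sum _ fun i _ => hX.measurable_gap i

lemma measurable_sales (j : Fin n) : Measurable fun z : ℝ × Ω => X.sales j z.1 z.2 :=
  measurable_ncard_setOf_mem fun k =>
    (measurableSet_le ((hX.measurable_arrival k).comp measurable_snd) measurable_fst).inter
      (measurable_snd (hX.measurable_choice k (some j)))

lemma measurable_salesBefore (j : Fin n) :
    Measurable fun z : ℝ × Ω => X.salesBefore j z.1 z.2 :=
  measurable_ncard_setOf_mem fun k =>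
    (measurableSet_lt ((hX.measurable_arrival k).comp measurable_snd) measurable_fst).inter
      (measurable_snd (hX.measurable_choice k (some j)))

lemma measurable_inventory : Measurable fun z : ℝ × Ω => X.inventory M z.1 z.2 :=
  measurable_pi_lambda _ fun _ => measurable_const.sub <| Finset.measurable_fun_sum _ fun j _ =>
    ((measurable_of_countable fun a : ℕ => (a : ℤ)).comp (hX.measurable_sales j)).const_mul _

lemma measurable_inventoryBefore : Measurable fun z : ℝ × Ω => X.inventoryBefore M z.1 z.2 :=
  measurable_pi_lambda _ fun _ => measurable_const.sub <| Finset.measurable_fun_sum _ fun j _ =>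
    ((measurable_of_countable fun a : ℕ => (a : ℤ)).comp (hX.measurable_salesBefore j)).const_mul _

lemma comap_offer_le (k : ℕ) : MeasurableSpace.comap (X.offer k) ⊤ ≤ ‹MeasurableSpace Ω› := by
  let _ : MeasurableSpace (Finset (Fin n)) := ⊤
  exact (measurable_to_countable' (hX.measurable_offer k)).comap_le

lemma comap_choice_le (k : ℕ) : MeasurableSpace.comap (X.choice k) ⊤ ≤ ‹MeasurableSpace Ω› := by
  let _ : MeasurableSpace (Option (Fin n)) := ⊤
  exact (measurable_to_countable' (hX.measurable_choice k)).comap_le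

lemma past_le (k : ℕ) : X.past k ≤ ‹MeasurableSpace Ω› :=
  sup_le (iSup_le fun i => (hX.measurable_gap i).comap_le)
    (iSup_le fun i => sup_le (hX.comap_offer_le i) (hX.comap_choice_le i))

end IsControlled

end Measurability

/-! ### Almost sure regularity and tails of the number of arrivals -/

section AlmostSure

/-- An event almost surely fails wherever its conditional probability vanishes. The set where it
vanishes need not be measurable. -/
lemma _root_.ae_notMem_of_condExp_indicator_eq_zero {𝒢 mΩ : MeasurableSpace Ω} {P : Measure Ω}
    [IsFiniteMeasure P] (h𝒢 : 𝒢 ≤ mΩ) {A : Set Ω} (hA : MeasurableSet[mΩ] A) :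
    ∀ᵐ ω ∂P, (P[A.indicator (fun _ => (1 : ℝ)) | 𝒢]) ω = 0 → ω ∉ A := by
  set f := P[A.indicator (fun _ => (1 : ℝ)) | 𝒢]
  have hB : MeasurableSet[𝒢] {ω | f ω = 0} :=
    stronglyMeasurable_condExp.measurable (measurableSet_singleton 0)
  have hint : Integrable (A.indicator fun _ => (1 : ℝ)) P := (integrable_const 1).indicator hA
  have hzero : ∫ ω in {ω | f ω = 0}, A.indicator (fun _ => (1 : ℝ)) ω ∂P = 0 := by
    rw [← setIntegral_condExp h𝒢 hint hB]
    exact setIntegral_eq_zero_of_forall_eq_zero fun ω hω => hω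
  rw [setIntegral_indicator hA, setIntegral_const, smul_eq_mul, mul_one,
    measureReal_eq_zero_iff, measure_eq_zero_iff_ae_notMem] at hzero
  filter_upwards [hzero] with ω hω h0 hωA
  exact hω ⟨h0, hωA⟩

variable [MeasurableSpace Ω] {P : Measure Ω} {M : Market m n}
  {π : Finset (Fin n) → ℝ → (Fin m → ℤ) → ℝ} {X}

namespace IsControlled

variable (hX : X.IsControlled P M π)
include hX

lemma ae_gap_pos (k : ℕ) : ∀ᵐ ω ∂P, 0 < X.gap k ω := by
  have := isProbabilityMeasure_expMeasure M.rate_pos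
  have h0 : expMeasure M.rate (Set.Iic 0) = 0 := by
    rw [← ofReal_cdf, cdf_expMeasure_eq M.rate_pos]
    simp
  rw [← hX.law_gap k, Measure.map_apply (hX.measurable_gap k) measurableSet_Iic,
    measure_eq_zero_iff_ae_notMem] at h0
  filter_upwards [h0] with ω hω
  exact not_le.1 hω

variable [IsProbabilityMeasure P]

lemma integrable_exp_neg_gap (k : ℕ) : Integrable (fun ω => Real.exp (-1 * X.gap k ω)) P := by
  refine Integrable.of_bound
    ((hX.measurable_gap k).const_mul (-1)).exp.aestronglyMeasurable 1 ?_
  filter_upwards [hX.ae_gap_pos k] with ω hω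
  rw [Real.norm_eq_abs, Real.abs_exp]
  exact Real.exp_le_one_iff.2 (by linarith)

lemma mgf_gap_lt_one : mgf (X.gap 0) P (-1) < 1 := by
  have hint := hX.integrable_exp_neg_gap 0
  have hpos : 0 < ∫ ω, (1 - Real.exp (-1 * X.gap 0 ω)) ∂P := by
    have hae : ∀ᵐ ω ∂P, 0 < 1 - Real.exp (-1 * X.gap 0 ω) := by
      filter_upwards [hX.ae_gap_pos 0] with ω hω
      exact sub_pos.2 (Real.exp_lt_one_iff.2 (by linarith))
    rw [integral_pos_iff_support_of_nonneg_ae (hae.mono fun _ => le_of_lt)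
      ((integrable_const 1).sub hint), measure_congr (t := Set.univ), measure_univ]
    · exact one_pos
    · exact Filter.eventuallyEq_univ.2 (hae.mono fun _ h => h.ne')
  rw [integral_sub (integrable_const 1) hint] at hpos
  simpa [mgf] using hpos

/-- Chernoff's bound: the number of arrivals up to time `t` has geometric tails. -/
lemma measureReal_arrival_le (k : ℕ) (t : ℝ) :
    P.real {ω | X.arrival k ω ≤ t} ≤ Real.exp t * mgf (X.gap 0) P (-1) ^ (k + 1) := by
  have harr : X.arrival k = ∑ i ∈ Finset.range (k + 1), X.gap i := by
    ext ω
    rw [Finset.sum_apply]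
    rfl
  have hident (i j : ℕ) : IdentDistrib (X.gap i) (X.gap j) P P :=
    ⟨(hX.measurable_gap i).aemeasurable, (hX.measurable_gap j).aemeasurable,
      (hX.law_gap i).trans (hX.law_gap j).symm⟩
  have hmgf := mgf_sum_of_identDistrib (s := Finset.range (k + 1)) (j := 0) hX.measurable_gap
    hX.indep_gap (fun i _ j _ => hident i j) (by simp) (-1)
  rw [Finset.card_range, ← harr] at hmgf
  have hint : Integrable (fun ω => Real.exp (-1 * X.arrival k ω)) P := by
    rw [harr]
    exact hX.indep_gap.integrable_exp_mul_sum hX.measurable_gap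
      fun i _ => hX.integrable_exp_neg_gap i
  have h := measure_le_le_exp_mul_mgf t (by norm_num : (-1 : ℝ) ≤ 0) hint
  rwa [hmgf, neg_neg, one_mul] at h

lemma tsum_mul_measure_arrival_le_ne_top (t : ℝ) :
    ∑' k : ℕ, ((2 * k + 1 : ℕ) : ℝ≥0∞) * P {ω | X.arrival k ω ≤ t} ≠ ∞ := by
  set r := mgf (X.gap 0) P (-1)
  have hr : ‖r‖ < 1 := by
    rw [Real.norm_of_nonneg mgf_nonneg]
    exact hX.mgf_gap_lt_one
  have hsum : Summable fun k : ℕ => ((2 * k + 1 : ℕ) : ℝ) * (Real.exp t * r ^ (k + 1)) := by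
    have h1 := (summable_pow_mul_geometric_of_norm_lt_one 1 hr).mul_left (2 * Real.exp t * r)
    have h0 := (summable_pow_mul_geometric_of_norm_lt_one 0 hr).mul_left (Real.exp t * r)
    refine (h1.add h0).congr fun k => ?_
    push_cast
    ring
  refine ne_top_of_le_ne_top hsum.tsum_ofReal_ne_top (ENNReal.tsum_le_tsum fun k => ?_)
  rw [ENNReal.ofReal_mul (by positivity), ENNReal.ofReal_natCast, ← ofReal_measureReal]
  gcongr
  exact hX.measureReal_arrival_le k t

lemma ae_arrival_unbounded : ∀ᵐ ω ∂P, ∀ t : ℝ, ∃ k, t < X.arrival k ω := by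
  have hfin (N : ℕ) : ∀ᵐ ω ∂P, {k | X.arrival k ω ≤ N}.Finite := by
    refine ae_finite_setOfPred_mem (s := fun k => {ω | X.arrival k ω ≤ N}) <|
      ne_top_of_le_ne_top (hX.tsum_mul_measure_arrival_le_ne_top N) <|
        ENNReal.tsum_le_tsum fun k => ?_
    exact le_mul_of_one_le_left' (by exact_mod_cast Nat.le_add_left 1 (2 * k))
  filter_upwards [ae_all_iff.2 hfin] with ω hω t
  obtain ⟨N, hN⟩ := exists_nat_ge t
  obtain ⟨k, hk⟩ := (hω N).infinite_compl.nonempty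
  exact ⟨k, hN.trans_lt (not_le.1 hk)⟩

lemma ae_isRegularPath (hπ : M.IsAdmissible π) : ∀ᵐ ω ∂P, X.IsRegularPath M ω := by
  have hoffer (k : ℕ) (S : Finset (Fin n)) :=
    ae_notMem_of_condExp_indicator_eq_zero (P := P) (hX.past_le k) (hX.measurable_offer k S)
  have hchoice (k : ℕ) (j : Option (Fin n)) :=
    ae_notMem_of_condExp_indicator_eq_zero (P := P)
      (sup_le (hX.past_le k) (hX.comap_offer_le k)) (hX.measurable_choice k j)
  filter_upwards [ae_all_iff.2 hX.ae_gap_pos, hX.ae_arrival_unbounded,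
    ae_all_iff.2 fun k => ae_all_iff.2 (hX.law_offer k),
    ae_all_iff.2 fun k => ae_all_iff.2 (hX.law_choice k),
    ae_all_iff.2 fun k => ae_all_iff.2 (hoffer k),
    ae_all_iff.2 fun k => ae_all_iff.2 (hchoice k)] with ω hpos hunb hlo hlc ho hc
  refine ⟨hpos, hunb, fun k hk hmem => ?_, fun k j hj => ?_⟩
  · by_contra hav
    have h0 : 0 ≤ X.arrival k ω := Finset.sum_nonneg fun i _ => (hpos i).le
    exact ho k _ ((hlo k _ hk).trans (hπ.eq_zero_of_notMem _ ⟨h0, hk⟩ _ hmem _ hav)) rfl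
  · by_contra hnot
    exact hc k _ ((hlc k _).trans (M.choiceProb_not_offered _ j hnot)) hj

end IsControlled

end AlmostSure

end Trajectory

/-! ### The entropy as a function of time and state -/

section Entropy

lemma Measurable.indicator_of_subtype {α : Type*} [MeasurableSpace α] {s : Set α}
    (hs : MeasurableSet s) {g : α → ℝ} (hg : Measurable fun a : s => g a) :
    Measurable (s.indicator g) := by
  classical
  convert (MeasurableEmbedding.subtype_coe hs).measurable_extend hg
    (measurable_const (a := (0 : ℝ))) using 1
  funext a
  by_cases ha : a ∈ s
  · rw [Set.indicator_of_mem ha]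
    exact (Subtype.val_injective.extend_apply (fun a : s => g a) _ ⟨a, ha⟩).symm
  · rw [Set.indicator_of_notMem ha, Function.extend_apply']
    rintro ⟨b, rfl⟩
    exact ha b.2

lemma Real.negMulLog_le_one {x : ℝ} (hx : 0 ≤ x) : Real.negMulLog x ≤ 1 := by
  rcases hx.eq_or_lt with rfl | hx
  · simp
  · have h := mul_le_mul_of_nonneg_left (Real.one_sub_inv_le_log_of_pos hx) hx.le
    rw [mul_sub, mul_one, mul_inv_cancel₀ hx.ne'] at h
    rw [Real.negMulLog]
    linarith

namespace Market

variable {m n : ℕ} {M : Market m n} {π : Finset (Fin n) → ℝ → (Fin m → ℤ) → ℝ}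

variable (M π) in
/-- The entropy, set to zero outside the times and states at which the policy is meaningful. -/
noncomputable def entropyOn : ℝ × (Fin m → ℤ) → ℝ :=
  (Set.Icc 0 M.horizon ×ˢ M.states).indicator fun z => M.entropy π z.1 z.2

variable (hπ : M.IsRandomizedMarkovPolicy π)
include hπ

lemma abs_entropyOn_le (z : ℝ × (Fin m → ℤ)) :
    |M.entropyOn π z| ≤ Fintype.card (Finset (Fin n)) := by
  by_cases hz : z ∈ Set.Icc 0 M.horizon ×ˢ M.states
  · rw [entropyOn, Set.indicator_of_mem hz, entropy]
    have hle (S : Finset (Fin n)) : |Real.negMulLog (π S z.1 z.2)| ≤ 1 := by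
      have h0 := hπ.nonneg _ hz.1 _ hz.2
      have h1 : π S z.1 z.2 ≤ 1 := by
        rw [← hπ.sum_eq_one _ hz.1 _ hz.2]
        exact Finset.single_le_sum (fun S' _ => h0 S') (Finset.mem_univ S)
      rw [abs_of_nonneg (Real.negMulLog_nonneg (h0 S) h1)]
      exact Real.negMulLog_le_one (h0 S)
    refine (Finset.abs_sum_le_sum_abs _ _).trans <| (Finset.sum_le_card_nsmul _ _ 1
      fun S _ => hle S).trans ?_
    rw [nsmul_one]
    exact_mod_cast Finset.card_le_univ _
  · rw [entropyOn, Set.indicator_of_notMem hz, abs_zero]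
    positivity

lemma measurable_entropyOn : Measurable (M.entropyOn π) := by
  refine measurable_from_prod_countable_left fun x => ?_
  by_cases hx : x ∈ M.states
  · convert Measurable.indicator_of_subtype (g := fun t => M.entropy π t x) measurableSet_Icc
      (Finset.measurable_fun_sum (M.available x) fun S _ =>
        Real.continuous_negMulLog.measurable.comp (hπ.measurable x hx S)) using 1
    funext t
    simp [entropyOn, Set.indicator, hx]
  · convert measurable_const (a := (0 : ℝ)) using 1
    funext t
    simp [entropyOn, hx]

end Market

end Entropy

namespace Trajectory

variable {m n : ℕ} {Ω : Type*} {X : Trajectory n Ω} {M : Market m n}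
  {π : Finset (Fin n) → ℝ → (Fin m → ℤ) → ℝ}

/-! ### Second moment of the reward-to-go and decomposition of the loss -/

section Reward

variable (X M π) in
/-- A version of the reward-to-go that is jointly measurable in time and path; it uses the
cut-off entropy `Market.entropyOn`. -/
noncomputable def rewardVersion (z : ℝ × Ω) : ℝ :=
  ∑ j, M.price j * ((X.sales j M.horizon z.2 : ℝ) - X.sales j z.1 z.2) +
    M.temperature * ∫ s, (Set.Ioc z.1 M.horizon).indicator
      (fun s => M.entropyOn π (s, X.inventoryBefore M s z.2)) s

lemma IsRegularPath.rewardToGo_eq {ω : Ω} (h : X.IsRegularPath M ω) {t : ℝ}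
    (ht : t ∈ Set.Icc 0 M.horizon) : X.rewardToGo M π t ω = X.rewardVersion M π (t, ω) := by
  rw [rewardToGo, rewardVersion, intervalIntegral.integral_of_le ht.2,
    integral_indicator measurableSet_Ioc]
  congr 2
  refine setIntegral_congr_fun measurableSet_Ioc fun s hs => ?_
  rw [Market.entropyOn, Set.indicator_of_mem]
  exact ⟨⟨ht.1.trans hs.1.le, hs.2⟩, h.inventoryBefore_mem_states hs.2⟩

lemma IsRegularPath.sq_rewardVersion_le (hπ : M.IsRandomizedMarkovPolicy π) {ω : Ω}
    (h : X.IsRegularPath M ω) {t : ℝ} (ht : t ∈ Set.Icc 0 M.horizon) :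
    X.rewardVersion M π (t, ω) ^ 2 ≤
      2 * (∑ j, M.price j ^ 2) * ∑ j, (X.sales j M.horizon ω : ℝ) ^ 2 +
        2 * (M.temperature * (Fintype.card (Finset (Fin n)) * M.horizon)) ^ 2 := by
  have hrev : (∑ j, M.price j * ((X.sales j M.horizon ω : ℝ) - X.sales j t ω)) ^ 2 ≤
      (∑ j, M.price j ^ 2) * ∑ j, (X.sales j M.horizon ω : ℝ) ^ 2 := by
    refine (Finset.sum_mul_sq_le_sq_mul_sq _ _ _).trans ?_
    gcongr with j
    · exact sub_nonneg.2 (Nat.cast_le.2 (h.sales_mono j ht.2))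
    · exact sub_le_self _ (Nat.cast_nonneg _)
  have hent : (M.temperature * ∫ s, (Set.Ioc t M.horizon).indicator
      (fun s => M.entropyOn π (s, X.inventoryBefore M s ω)) s) ^ 2 ≤
        (M.temperature * (Fintype.card (Finset (Fin n)) * M.horizon)) ^ 2 := by
    rw [integral_indicator measurableSet_Ioc, mul_pow, mul_pow]
    have hle := norm_setIntegral_le_of_norm_le_const (μ := volume)
      (f := fun s => M.entropyOn π (s, X.inventoryBefore M s ω))
      (measure_Ioc_lt_top (a := t) (b := M.horizon)) fun s _ => Market.abs_entropyOn_le hπ _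
    rw [Real.volume_real_Ioc_of_le ht.2] at hle
    refine mul_le_mul_of_nonneg_left (sq_le_sq.2 (hle.trans (le_trans ?_ (le_abs_self _))))
      (sq_nonneg _)
    gcongr
    linarith [ht.1]
  rw [rewardVersion]
  refine add_sq_le.trans ?_
  linarith

variable [MeasurableSpace Ω] {P : Measure Ω}

namespace IsControlled

variable (hX : X.IsControlled P M π)
include hX

lemma measurable_rewardVersion (hπ : M.IsRandomizedMarkovPolicy π) :
    Measurable (X.rewardVersion M π) := by
  refine Measurable.add (Finset.measurable_fun_sum _ fun j _ => Measurable.const_mul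
    (Measurable.sub ?_ ?_) _) (Measurable.const_mul ?_ _)
  · exact measurable_from_nat.comp
      ((hX.measurable_sales j).comp (measurable_const.prodMk measurable_snd))
  · exact measurable_from_nat.comp (hX.measurable_sales j)
  · have hs : MeasurableSet {y : (ℝ × Ω) × ℝ | y.1.1 < y.2 ∧ y.2 ≤ M.horizon} :=
      (measurableSet_lt (measurable_fst.comp measurable_fst) measurable_snd).inter
        (measurableSet_le measurable_snd measurable_const)
    have hpair : Measurable fun y : (ℝ × Ω) × ℝ => (y.2, y.1.2) :=
      measurable_snd.prodMk (measurable_snd.comp measurable_fst)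
    have hinv := hX.measurable_inventoryBefore.comp hpair
    simp only [Function.comp_def] at hinv
    have hent : Measurable fun y : (ℝ × Ω) × ℝ =>
        M.entropyOn π (y.2, X.inventoryBefore M y.2 y.1.2) :=
      (Market.measurable_entropyOn hπ).comp (measurable_snd.prodMk hinv)
    have hind := hent.indicator hs
    exact hind.stronglyMeasurable.integral_prod_right'.measurable

variable [IsProbabilityMeasure P]

lemma lintegral_sq_sales_ne_top (hπ : M.IsAdmissible π) (j : Fin n) (t : ℝ) :
    ∫⁻ ω, ENNReal.ofReal ((X.sales j t ω : ℝ) ^ 2) ∂P ≠ ∞ := by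
  refine ne_top_of_le_ne_top (hX.tsum_mul_measure_arrival_le_ne_top t) ?_
  have hs (k : ℕ) : MeasurableSet {ω | X.arrival k ω ≤ t} :=
    measurableSet_le (hX.measurable_arrival k) measurable_const
  calc ∫⁻ ω, ENNReal.ofReal ((X.sales j t ω : ℝ) ^ 2) ∂P
      ≤ ∫⁻ ω, ∑' k : ℕ, {ω' | X.arrival k ω' ≤ t}.indicator
          (fun _ => ((2 * k + 1 : ℕ) : ℝ≥0∞)) ω ∂P :=
        lintegral_mono_ae <| (hX.ae_isRegularPath hπ).mono fun ω h => h.sq_sales_le j t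
    _ = _ := by
        rw [lintegral_tsum fun k => (measurable_const.indicator (hs k)).aemeasurable]
        exact tsum_congr fun k => lintegral_indicator_const (hs k) _

lemma lintegral_sq_rewardVersion_ne_top (hπ : M.IsAdmissible π) :
    ∫⁻ ω, (∫⁻ t in Set.Icc 0 M.horizon,
      ENNReal.ofReal (X.rewardVersion M π (t, ω) ^ 2)) ∂P ≠ ∞ := by
  set a : ℝ := 2 * ∑ j, M.price j ^ 2
  set b : ℝ := 2 * (M.temperature * (Fintype.card (Finset (Fin n)) * M.horizon)) ^ 2
  have ha0 : 0 ≤ a := by positivity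
  have hb0 : 0 ≤ b := by positivity
  have hbound : ∀ᵐ ω ∂P, ∫⁻ t in Set.Icc 0 M.horizon,
      ENNReal.ofReal (X.rewardVersion M π (t, ω) ^ 2) ≤
        (ENNReal.ofReal a * ∑ j, ENNReal.ofReal ((X.sales j M.horizon ω : ℝ) ^ 2) +
          ENNReal.ofReal b) * volume (Set.Icc 0 M.horizon) := by
    filter_upwards [hX.ae_isRegularPath hπ] with ω h
    rw [← setLIntegral_const]
    refine setLIntegral_mono' measurableSet_Icc fun t ht => ?_
    rw [← ENNReal.ofReal_sum_of_nonneg fun _ _ => sq_nonneg _, ← ENNReal.ofReal_mul ha0,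
      ← ENNReal.ofReal_add (by positivity) hb0]
    exact ENNReal.ofReal_le_ofReal (h.sq_rewardVersion_le hπ.toIsRandomizedMarkovPolicy ht)
  refine ne_top_of_le_ne_top ?_ (lintegral_mono_ae hbound)
  have hm (j : Fin n) :
      Measurable fun ω => ENNReal.ofReal ((X.sales j M.horizon ω : ℝ) ^ 2) :=
    ((measurable_from_nat.comp ((hX.measurable_sales j).comp
      (measurable_const.prodMk measurable_id))).pow_const 2).ennreal_ofReal
  rw [lintegral_mul_const' _ _ measure_Icc_lt_top.ne, lintegral_add_right _ measurable_const,
    lintegral_const_mul' _ _ ENNReal.ofReal_ne_top, lintegral_finsetSum _ fun j _ => hm j,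
    lintegral_const, measure_univ, mul_one]
  refine ENNReal.mul_ne_top (ENNReal.add_ne_top.2 ⟨ENNReal.mul_ne_top ENNReal.ofReal_ne_top ?_,
    ENNReal.ofReal_ne_top⟩) measure_Icc_lt_top.ne
  exact ENNReal.sum_ne_top.2 fun j _ => hX.lintegral_sq_sales_ne_top hπ j _

lemma value_eq (hπ : M.IsAdmissible π) {t : ℝ} (ht : t ∈ Set.Icc 0 M.horizon)
    (x : Fin m → ℤ) :
    X.value P M π t x = ∫ ω, X.rewardVersion M π (t, ω)
      ∂(ProbabilityTheory.cond P ((fun ω => X.inventory M t ω) ⁻¹' {x})) :=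
  integral_congr_ae <| cond_absolutelyContinuous.ae_le <|
    (hX.ae_isRegularPath hπ).mono fun _ h => h.rewardToGo_eq ht

/-- The two losses differ by the expected integrated conditional variance of the reward-to-go. -/
lemma exists_monteCarloLoss_eq_msve_add (hπ : M.IsAdmissible π) :
    ∃ C : ℝ≥0, ∀ v : ℝ → (Fin m → ℤ) → ℝ,
      (∀ x ∈ M.states, Measurable fun t : Set.Icc (0 : ℝ) M.horizon => v t x) →
        X.monteCarloLoss P M π v = X.msve P M π v + C := by
  have hG := hX.measurable_rewardVersion hπ.toIsRandomizedMarkovPolicy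
  obtain ⟨C, hC⟩ := exists_lintegral_sq_sub_eq_add P (volume.restrict (Set.Icc 0 M.horizon))
    hX.measurable_inventory hG (hX.lintegral_sq_rewardVersion_ne_top hπ)
  refine ⟨2⁻¹ * C, fun v hv => ?_⟩
  -- Nothing is known about `v` off the horizon and the state space, and `v'` vanishes there.
  set v' : ℝ → (Fin m → ℤ) → ℝ := fun t x =>
    M.states.indicator (fun x => (Set.Icc 0 M.horizon).indicator (fun t => v t x) t) x with hv'
  have hv'_eq {t : ℝ} {x : Fin m → ℤ} (ht : t ∈ Set.Icc 0 M.horizon) (hx : x ∈ M.states) :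
      v' t x = v t x := by
    simp only [hv', Set.indicator_of_mem hx, Set.indicator_of_mem ht]
  have hv'_meas (x : Fin m → ℤ) : Measurable fun t => v' t x := by
    by_cases hx : x ∈ M.states
    · simp only [hv', Set.indicator_of_mem hx]
      exact Measurable.indicator_of_subtype measurableSet_Icc (hv x hx)
    · simp only [hv', Set.indicator_of_notMem hx]
      exact measurable_const
  have hloss : X.monteCarloLoss P M π v = 2⁻¹ * ∫⁻ ω, (∫⁻ t in Set.Icc 0 M.horizon,
      ENNReal.ofReal ((X.rewardVersion M π (t, ω) - v' t (X.inventory M t ω)) ^ 2)) ∂P := by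
    rw [monteCarloLoss]
    congr 1
    refine lintegral_congr_ae ?_
    filter_upwards [hX.ae_isRegularPath hπ] with ω h
    refine setLIntegral_congr_fun measurableSet_Icc fun t ht => ?_
    rw [h.rewardToGo_eq ht, hv'_eq ht (h.inventory_mem_states ht.2)]
  have hmsve : X.msve P M π v = 2⁻¹ * ∫⁻ ω, (∫⁻ t in Set.Icc 0 M.horizon,
      ENNReal.ofReal (((∫ ω', X.rewardVersion M π (t, ω') ∂(ProbabilityTheory.cond P
        ((fun ω' => X.inventory M t ω') ⁻¹' {X.inventory M t ω}))) -
          v' t (X.inventory M t ω)) ^ 2)) ∂P := by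
    rw [msve]
    congr 1
    refine lintegral_congr_ae ?_
    filter_upwards [hX.ae_isRegularPath hπ] with ω h
    refine setLIntegral_congr_fun measurableSet_Icc fun t ht => ?_
    rw [sq_abs, hX.value_eq hπ ht, hv'_eq ht (h.inventory_mem_states ht.2)]
  rw [hloss, hmsve]
  refine (congrArg (2⁻¹ * ·) (hC v' hv'_meas)).trans ((mul_add _ _ _).trans ?_)
  congr 1
  rw [ENNReal.coe_mul, ENNReal.coe_inv two_ne_zero, ENNReal.coe_ofNat]

end IsControlled

end Reward

end Trajectory

lemma argmin_eq_of_eq_add {Θ : Type*} {f g : Θ → ℝ≥0∞} {C : ℝ≥0} (h : ∀ θ, f θ = g θ + C) :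
    argmin f = argmin g := by
  ext θ
  simp only [argmin, Set.mem_ofPred_eq, h, ENNReal.add_le_add_iff_right ENNReal.coe_ne_top]

theorem theorem1 {m n : ℕ} (M : Market m n)
    (π : Finset (Fin n) → ℝ → (Fin m → ℤ) → ℝ) (hπ : M.IsAdmissible π)
    {Ω : Type*} [MeasurableSpace Ω] (P : Measure Ω) [IsProbabilityMeasure P]
    (X : Trajectory n Ω) (hX : X.IsControlled P M π)
    {Θ : Type*} (J : Θ → ℝ → (Fin m → ℤ) → ℝ)
    (hJ : ∀ θ, ∀ x ∈ M.states, Measurable fun t : Set.Icc (0 : ℝ) M.horizon => J θ t x) :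
    argmin (fun θ => X.monteCarloLoss P M π (J θ)) = argmin (fun θ => X.msve P M π (J θ)) ∧
      ∃ C : ℝ≥0, ∀ θ, X.monteCarloLoss P M π (J θ) = X.msve P M π (J θ) + C := by
  obtain ⟨C, hC⟩ := hX.exists_monteCarloLoss_eq_msve_add hπ
  have h θ := hC (J θ) (hJ θ)
  exact ⟨argmin_eq_of_eq_add h, C, h⟩
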